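/- Let $d,N\ge 1$ be integers. For $k\ge 1$ and $x_1,\dots,x_k\in\mathbb{R}^d$ let $$c_k(x_1,\dots,x_k)=\sum_{1\le i<j\le k}\frac1{|x_i-x_j|}\in[0,+\infty]$$ (with $1/0=+\infty$, and $c_1=0$). For a Borel probability measure $\rho$ on $\mathbb{R}^d$ let $$C(\rho)=\inf\Big\{\int c_N\,dP\ :\ P \text{ a Borel probability on } (\mathbb{R}^d)^N \text{ with all } N \text{ marginals equal to } \rho\Big\}.$$ Let $\mathcal{P}^-$ be the set of nonnegative Borel measures $\rho$ on $\mathbb{R}^d$ with mass $\|\rho\|=\rho(\mathbb{R}^d)\le 1$, and for $\rho\in\mathcal{P}^-$ let $$\overline{C}(\rho)=\inf\Big\{\liminf_{n\to\infty} C(\rho_n)\ :\ \rho_n \text{ probabilities},\ \rho_n\stackrel{*}{\rightharpoonup}\rho\Big\},$$ where weak* convergence is tested against the space $C_0$ of continuous real functions on $\mathbb{R}^d$ vanishing at infinity. For $\varphi\in C_0$ and $k\ge1$ put $$M_k(\varphi)=\sup\Big\{\frac1k\sum_{i=1}^k\varphi(x_i)-c_k(x_1,\dots,x_k)\ :\ x_1,\dots,x_k\in\mathbb{R}^d\Big\},\qquad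 M_0=0.$$ For $V\in C_0$ let $\mathcal{S}_V$ be the set of minimizers of $\rho\mapsto\overline{C}(\rho)-\int V\,d\rho$ over $\mathcal{P}^-$. If $V^+=\max\{V,0\}$ does not vanish identically, put $$k_N(V)=\max\Big\{k\in\{1,\dots,N\}\ :\ M_k\Big(\frac kN V\Big)>M_{k-1}\Big(\frac{k-1}N V\Big)\Big\},$$ and put $k_N(V)=0$ if $V^+\equiv 0$. Theorem (quantization of mass). For every $V\in C_0$, if $V^+\not\equiv0$ then the maximum defining $k_N(V)$ exists; the minimum $\mathcal{I}_N(V)=\min\{\|\rho\| : \rho\in\mathcal{S}_V\}$ is attained, and $$\mathcal{I}_N(V)=\frac{k_N(V)}{N}.$$ Consequently the map $V\in C_0\mapsto\mathcal{I}_N(V)$ takes its values in the finite set $\{k/N : 0\le k\le N\}$. -/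

import Mathlib

open MeasureTheory Filter
open scoped ENNReal ZeroAtInfty Topology

namespace CoulombMass

/-- The ambient space `ℝ^d` with its Euclidean norm. -/
abbrev Space (d : ℕ) : Type := EuclideanSpace ℝ (Fin d)

/-- The Coulomb cost `c_k(x₁, …, x_k) = ∑_{i < j} 1 / |x_i - x_j|`, with the value `∞` as soon as
two of the points coincide; `edist` is the Euclidean distance with values in `[0, ∞]`. -/
noncomputable def coulombCost {d : ℕ} (k : ℕ) (x : Fin k → Space d) : ℝ≥0∞ :=
  ∑ i : Fin k, ∑ j ∈ Finset.Ioi i, (edist (x i) (x j))⁻¹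

/-- The transport plans `Π(ρ)`: probabilities on `(ℝ^d)^N` all of whose marginals are `ρ`. -/
def plans {d : ℕ} (N : ℕ) (ρ : Measure (Space d)) : Set (Measure (Fin N → Space d)) :=
  {P | IsProbabilityMeasure P ∧ ∀ i : Fin N, P.map (fun x => x i) = ρ}

/-- The multi-marginal cost `C(ρ) = inf {∫ c dP : P ∈ Π(ρ)}`. -/
noncomputable def transportCost {d : ℕ} (N : ℕ) (ρ : Measure (Space d)) : ℝ≥0∞ :=
  ⨅ P ∈ plans N ρ, ∫⁻ x, coulombCost N x ∂P

/-- Weak* convergence of a sequence of measures, tested on functions vanishing at infinity. -/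
def WeakStarTendsto {d : ℕ} (ρs : ℕ → Measure (Space d)) (ρ : Measure (Space d)) : Prop :=
  ∀ φ : C₀(Space d, ℝ), Tendsto (fun n => ∫ x, φ x ∂(ρs n)) atTop (𝓝 (∫ x, φ x ∂ρ))

/-- The relaxed cost: the infimum of `liminf C(ρ_n)` over the sequences of probabilities `ρ_n`
that converge weakly* to `ρ`. -/
noncomputable def relaxedCost {d : ℕ} (N : ℕ) (ρ : Measure (Space d)) : ℝ≥0∞ :=
  sInf {a | ∃ ρs : ℕ → Measure (Space d), (∀ n, IsProbabilityMeasure (ρs n)) ∧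
    WeakStarTendsto ρs ρ ∧ a = liminf (fun n => transportCost N (ρs n)) atTop}

/-- The Borel sub-probabilities on `ℝ^d`. -/
def subProb (d : ℕ) : Set (Measure (Space d)) := {ρ | ρ Set.univ ≤ 1}

/-- The functional `ρ ↦ C̄(ρ) - ∫ V dρ`, with values in `(-∞, ∞]` on sub-probabilities. -/
noncomputable def energy {d : ℕ} (N : ℕ) (V : C₀(Space d, ℝ)) (ρ : Measure (Space d)) : EReal :=
  (relaxedCost N ρ : EReal) - ((∫ x, V x ∂ρ : ℝ) : EReal)

/-- The set `S_V` of minimizers of the relaxed problem over sub-probabilities. -/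
def minimizers {d : ℕ} (N : ℕ) (V : C₀(Space d, ℝ)) : Set (Measure (Space d)) :=
  {ρ | ρ ∈ subProb d ∧ ∀ σ ∈ subProb d, energy N V ρ ≤ energy N V σ}

/-- The set of masses `‖ρ‖` of the minimizers. -/
def minimizerMasses {d : ℕ} (N : ℕ) (V : C₀(Space d, ℝ)) : Set ℝ :=
  {m | ∃ ρ ∈ minimizers N V, m = ρ.real Set.univ}

/-- The minimal mass `I_N(V)` of a minimizer. -/
noncomputable def minMass {d : ℕ} (N : ℕ) (V : C₀(Space d, ℝ)) : ℝ :=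
  sInf (minimizerMasses N V)

/-- `M_k(φ) = sup {(1/k) ∑ φ(x_i) - c_k(x₁, …, x_k)}`, over all `x₁, …, x_k` in `ℝ^d`. -/
noncomputable def M {d : ℕ} (k : ℕ) (φ : C₀(Space d, ℝ)) : EReal :=
  ⨆ x : Fin k → Space d,
    ((1 / (k : ℝ) * ∑ i, φ (x i) : ℝ) : EReal) - (coulombCost k x : EReal)

/-- The convention `M_0 = 0` holds for the formula above. -/
theorem M_zero {d : ℕ} (φ : C₀(Space d, ℝ)) : M 0 φ = 0 := by
  simp [M, coulombCost]

/-- The indices `k ∈ {1, …, N}` with `M_k(kV/N) > M_{k-1}((k-1)V/N)`. -/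
def strictIndices {d : ℕ} (N : ℕ) (V : C₀(Space d, ℝ)) : Set ℕ :=
  {k | 1 ≤ k ∧ k ≤ N ∧
    M (k - 1) ((((k - 1 : ℕ) : ℝ) / (N : ℝ)) • V) < M k (((k : ℝ) / (N : ℝ)) • V)}

open Classical in
/-- `k_N(V)`: the largest element of `strictIndices N V` if `V⁺` does not vanish identically,
and `0` otherwise. -/
noncomputable def kIndex {d : ℕ} (N : ℕ) (V : C₀(Space d, ℝ)) : ℕ :=
  if ∃ x, 0 < V x then sSup (strictIndices N V) else 0

end CoulombMass

namespace CoulombMass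

variable {d : ℕ}

/-! ### The Coulomb cost -/

/-! With the factors k/N absorbed, M_k((k/N)V) is the supremum of (1/N)∑V(x_i) - c_k(x) over k
points (`scaledM`). It is nondecreasing in k, since surplus points can be sent to infinity at no
cost (`exists_escaping_extension`); when V is positive somewhere, k_N(V) is therefore the index at
which it reaches its value t at k = N.

Duality makes -t a lower bound for the energy (`neg_le_energy`). At the last strict increase no
point of a maximizing configuration can escape, so a maximizer exists (`exists_scaledM_eq`); its
k_N(V) points, each with mass 1/N, form a measure of energy -t. This gives a minimizer of mass
k_N(V)/N.

No minimizer is lighter (`le_measureReal_of_energy_le`): subtracting a suitable bump cφ from V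
lowers the N-point supremum by a definite δ, since a near-optimal configuration must keep k_N(V)
points where φ = 1. Duality for V - cφ then gives δ ≤ c∫φ dρ for every minimizer ρ, and c is tuned
so that this reads ‖ρ‖ ≥ k_N(V)/N. -/

theorem coulombCost_eq_sum_ite (k : ℕ) (x : Fin k → Space d) :
    coulombCost k x = ∑ i, ∑ j, if i < j then (edist (x i) (x j))⁻¹ else 0 := by
  unfold coulombCost
  refine Finset.sum_congr rfl fun i _ => ?_
  rw [← Finset.sum_filter]
  congr 1
  ext j
  simp

theorem continuous_coulombCost (k : ℕ) :
    Continuous (coulombCost k : (Fin k → Space d) → ℝ≥0∞) := by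
  unfold coulombCost
  refine continuous_finsetSum _ fun i _ => continuous_finsetSum _ fun j _ => ?_
  exact ((continuous_apply i).edist (continuous_apply j)).inv

/-- Twice the cost is a sum over all ordered pairs i ≠ j, which any permutation merely reindexes. -/
theorem coulombCost_comp_perm (k : ℕ) (x : Fin k → Space d) (σ : Equiv.Perm (Fin k)) :
    coulombCost k (x ∘ σ) = coulombCost k x := by
  have key : ∀ y : Fin k → Space d, coulombCost k y + coulombCost k y =
      ∑ i, ∑ j, if i ≠ j then (edist (y i) (y j))⁻¹ else 0 := by
    intro y
    have hswap : coulombCost k y = ∑ i, ∑ j, if j < i then (edist (y i) (y j))⁻¹ else 0 := by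
      rw [coulombCost_eq_sum_ite, Finset.sum_comm]
      simp_rw [edist_comm]
    nth_rewrite 2 [hswap]
    rw [coulombCost_eq_sum_ite]
    simp_rw [← Finset.sum_add_distrib]
    refine Finset.sum_congr rfl fun i _ => Finset.sum_congr rfl fun j _ => ?_
    rcases lt_trichotomy i j with h | h | h
    · simp [h, h.ne, h.not_gt]
    · simp [h]
    · simp [h, h.ne', h.not_gt]
  have h2 : (2 : ℝ≥0∞) * coulombCost k (x ∘ σ) = 2 * coulombCost k x := by
    rw [two_mul, two_mul, key, key]
    conv_rhs => rw [← Equiv.sum_comp σ]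
    refine Finset.sum_congr rfl fun i _ => ?_
    conv_rhs => rw [← Equiv.sum_comp σ]
    simp
  exact (ENNReal.mul_right_inj (by simp) (by simp)).1 h2

theorem sum_comp_orderEmb {A : Type*} [AddCommMonoid A] {k m : ℕ} (e : Fin k ↪o Fin m)
    [DecidablePred (· ∈ Set.range e)] (F : Fin m → A) :
    ∑ i, F (e i) = ∑ a, if a ∈ Set.range e then F a else 0 := by
  rw [← Finset.sum_filter]
  have : Finset.univ.filter (· ∈ Set.range e) = Finset.univ.map e.toEmbedding := by
    ext a; simp
  rw [this, Finset.sum_map]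
  rfl

open Classical in
theorem coulombCost_comp_orderEmb {k m : ℕ} (e : Fin k ↪o Fin m) (w : Fin m → Space d) :
    coulombCost k (w ∘ e) = ∑ a, ∑ b, if a ∈ Set.range e ∧ b ∈ Set.range e ∧ a < b then
      (edist (w a) (w b))⁻¹ else 0 := by
  have h (i : Fin k) : (∑ j, if i < j then (edist ((w ∘ e) i) ((w ∘ e) j))⁻¹ else 0) =
      ∑ b, if b ∈ Set.range e then (if e i < b then (edist (w (e i)) (w b))⁻¹ else 0) else 0 := by
    rw [← sum_comp_orderEmb e (fun b => if e i < b then (edist (w (e i)) (w b))⁻¹ else 0)]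
    simp
  rw [coulombCost_eq_sum_ite, Finset.sum_congr rfl fun i _ => h i,
    sum_comp_orderEmb e (fun a => ∑ b, if b ∈ Set.range e then
      (if a < b then (edist (w a) (w b))⁻¹ else 0) else 0)]
  refine Finset.sum_congr rfl fun a _ => ?_
  by_cases ha : a ∈ Set.range e
  · simp only [ha, if_true, true_and, ite_and]
  · simp only [ha, if_false, false_and, Finset.sum_const_zero]

theorem coulombCost_comp_orderEmb_le {k m : ℕ} (e : Fin k ↪o Fin m) (w : Fin m → Space d) :
    coulombCost k (w ∘ e) ≤ coulombCost m w := by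
  classical
  rw [coulombCost_comp_orderEmb, coulombCost_eq_sum_ite]
  refine Finset.sum_le_sum fun a _ => Finset.sum_le_sum fun b _ => ?_
  split_ifs with h1 h2 h2
  · exact le_rfl
  · exact absurd h1.2.2 h2
  · exact zero_le
  · exact le_rfl

/-- A configuration of `k` points extends to one of `m` points whose new points escape to infinity
and from each other. -/
theorem exists_escaping_extension (hd : 1 ≤ d) {k m : ℕ} (e : Fin k ↪o Fin m)
    (x : Fin k → Space d) :
    ∃ z : ℕ → Fin m → Space d,
      Tendsto (fun n => coulombCost m (z n)) atTop (𝓝 (coulombCost k x)) ∧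
      ∀ φ : C₀(Space d, ℝ),
        Tendsto (fun n => ∑ a, φ (z n a)) atTop (𝓝 (∑ i, φ (x i))) := by
  classical
  let u : Space d := EuclideanSpace.single ⟨0, hd⟩ 1
  have hu : ‖u‖ = 1 := by simp [u]
  have hdist (p q : ℝ) : dist (p • u) (q • u) = |p - q| := by
    rw [dist_eq_norm, ← sub_smul, norm_smul, hu, mul_one, Real.norm_eq_abs]
  -- The new points run along one ray at distinct speeds a + 1, so they leave every bounded set and
  -- separate from each other linearly in n.
  let z : ℕ → Fin m → Space d := fun n =>
    Function.extend e x (fun a => ((n : ℝ) * ((a : ℕ) + 1)) • u)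
  let w : Fin m → Space d := z 0
  have hin (n : ℕ) (i : Fin k) : z n (e i) = x i := e.injective.extend_apply _ _ _
  have hout (n : ℕ) (a : Fin m) (ha : a ∉ Set.range e) :
      z n a = ((n : ℝ) * ((a : ℕ) + 1)) • u :=
    Function.extend_apply' _ _ _ (by simpa using ha)
  have hw : w ∘ e = x := funext fun i => hin 0 i
  have hnorm (a : Fin m) (ha : a ∉ Set.range e) :
      Tendsto (fun n => ‖z n a‖) atTop atTop := by
    have : ∀ n : ℕ, ‖z n a‖ = (n : ℝ) * ((a : ℕ) + 1) := by
      intro n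
      rw [hout n a ha, norm_smul, hu, mul_one, Real.norm_eq_abs, abs_of_nonneg (by positivity)]
    simp_rw [this]
    exact tendsto_natCast_atTop_atTop.atTop_mul_const (by positivity)
  have hinv {y y' : ℕ → Space d} (h : Tendsto (fun n => dist (y n) (y' n)) atTop atTop) :
      Tendsto (fun n => (edist (y n) (y' n))⁻¹) atTop (𝓝 0) := by
    rw [← ENNReal.inv_top, tendsto_inv_iff]
    simp_rw [edist_dist]
    exact ENNReal.tendsto_ofReal_atTop.comp h
  have hmixed (i : Fin k) (b : Fin m) (hb : b ∉ Set.range e) :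
      Tendsto (fun n => dist (z n b) (z n (e i))) atTop atTop := by
    refine tendsto_atTop_mono (f := fun n => ‖z n b‖ + -‖x i‖) (fun n => ?_)
      (tendsto_atTop_add_const_right _ _ (hnorm b hb))
    rw [hin, dist_eq_norm]
    linarith [norm_sub_norm_le (z n b) (x i)]
  refine ⟨z, ?_, fun φ => ?_⟩
  · have hc : coulombCost k x = _ := hw ▸ coulombCost_comp_orderEmb e w
    rw [hc]
    simp_rw [coulombCost_eq_sum_ite]
    refine tendsto_finsetSum _ fun a _ => tendsto_finsetSum _ fun b _ => ?_
    by_cases hab : a < b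
    · simp only [hab, and_true, if_true]
      by_cases ha : a ∈ Set.range e <;> by_cases hb : b ∈ Set.range e
      · obtain ⟨i, rfl⟩ := ha
        obtain ⟨j, rfl⟩ := hb
        simp [w, hin]
      · obtain ⟨i, rfl⟩ := ha
        simp only [hb, and_false, if_false]
        simp_rw [edist_comm (z _ (e i))]
        exact hinv (hmixed i b hb)
      · obtain ⟨j, rfl⟩ := hb
        simp only [ha, false_and, if_false]
        exact hinv (hmixed j a ha)
      · simp only [ha, false_and, if_false]
        refine hinv ?_
        have hne : (0 : ℝ) < |((a : ℕ) : ℝ) - (b : ℕ)| :=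
          abs_pos.2 (sub_ne_zero.2 (by exact_mod_cast (Fin.val_ne_of_ne hab.ne)))
        have : ∀ n : ℕ, dist (z n a) (z n b) = (n : ℝ) * |((a : ℕ) : ℝ) - (b : ℕ)| := by
          intro n
          rw [hout n a ha, hout n b hb, hdist, ← mul_sub, abs_mul, Nat.abs_cast]
          congr 2
          ring
        simp_rw [this]
        exact tendsto_natCast_atTop_atTop.atTop_mul_const hne
    · simp [hab]
  · have hx : ∑ i, φ (x i) = ∑ a, if a ∈ Set.range e then φ (w a) else 0 := by
      rw [← sum_comp_orderEmb e (fun a => φ (w a)), ← hw]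
      rfl
    rw [hx]
    refine tendsto_finsetSum _ fun a _ => ?_
    by_cases ha : a ∈ Set.range e
    · obtain ⟨i, rfl⟩ := ha
      simp [w, hin]
    · simp only [ha, if_false]
      exact φ.zero_at_infty'.comp (by
        rw [← Metric.cobounded_eq_cocompact, ← comap_norm_atTop]
        exact tendsto_comap_iff.2 (hnorm a ha))

/-! ### The suprema `M_k((k/N) V)` -/

/-- Truncating a - s at 0 loses nothing because c ≥ 0; bounds in `EReal` thus become bounds in
`ℝ≥0∞`, which can be integrated and passed to the limit. -/
theorem coe_sub_coe_ennreal_le_iff {a s : ℝ} {c : ℝ≥0∞} :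
    (a : EReal) - (c : EReal) ≤ s ↔ ENNReal.ofReal (a - s) ≤ c := by
  induction c with
  | top => simp
  | coe c =>
    rw [ENNReal.ofReal_le_iff_le_toReal ENNReal.coe_ne_top, ENNReal.coe_toReal,
      EReal.coe_nnreal_eq_coe_real, ← EReal.coe_sub, EReal.coe_le_coe_iff]
    constructor <;> intro h <;> linarith

/-- The average `(1/N) ∑ V(x_i)` with a normalization independent of the number of points. -/
noncomputable def scaledSum (N : ℕ) (V : C₀(Space d, ℝ)) {k : ℕ} (x : Fin k → Space d) : ℝ :=
  1 / (N : ℝ) * ∑ i, V (x i)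

/-- The supremum of `(1/N) ∑ V(x_i) - c_k(x)` over the configurations of `k` points. -/
noncomputable def scaledM (N : ℕ) (V : C₀(Space d, ℝ)) (k : ℕ) : EReal :=
  ⨆ x : Fin k → Space d, (scaledSum N V x : EReal) - (coulombCost k x : EReal)

theorem M_smul (N : ℕ) (V : C₀(Space d, ℝ)) (k : ℕ) :
    M k (((k : ℝ) / (N : ℝ)) • V) = scaledM N V k := by
  unfold M scaledM scaledSum
  congr! 3 with x
  rcases Nat.eq_zero_or_pos k with rfl | hk
  · simp
  · simp only [ZeroAtInftyContinuousMap.smul_apply, smul_eq_mul, ← Finset.mul_sum]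
    field_simp

theorem scaledM_zero (N : ℕ) (V : C₀(Space d, ℝ)) : scaledM N V 0 = 0 := by
  simp [scaledM, scaledSum, coulombCost]

theorem scaledM_le_iff {N : ℕ} {V : C₀(Space d, ℝ)} {k : ℕ} {s : ℝ} :
    scaledM N V k ≤ s ↔
      ∀ x : Fin k → Space d, ENNReal.ofReal (scaledSum N V x - s) ≤ coulombCost k x := by
  simp_rw [scaledM, iSup_le_iff, coe_sub_coe_ennreal_le_iff]

/-- Padding k points with escaping ones changes neither the cost nor the sum of V in the limit. -/
theorem scaledM_mono (hd : 1 ≤ d) (N : ℕ) (V : C₀(Space d, ℝ)) : Monotone (scaledM N V) := by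
  intro k m hkm
  refine EReal.le_of_forall_lt_iff_le.1 fun s hs => scaledM_le_iff.2 fun x => ?_
  obtain ⟨z, hz, hzV⟩ := exists_escaping_extension hd (Fin.castLEOrderEmb hkm) x
  refine le_of_tendsto_of_tendsto' (ENNReal.tendsto_ofReal (((hzV V).const_mul _).sub_const s)) hz
    fun n => scaledM_le_iff.1 hs.le (z n)

theorem exists_scaledM_eq_coe (hd : 1 ≤ d) (N : ℕ) (V : C₀(Space d, ℝ)) (k : ℕ) :
    ∃ s : ℝ, scaledM N V k = s := by
  have h0 : 0 ≤ scaledM N V k := scaledM_zero N V ▸ scaledM_mono hd N V k.zero_le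
  have h1 : scaledM N V k ≤ ((1 / (N : ℝ) * (k * ‖V.toBCF‖) : ℝ) : EReal) := by
    refine scaledM_le_iff.2 fun x => ?_
    rw [ENNReal.ofReal_of_nonpos]
    · exact zero_le
    · rw [scaledSum, sub_nonpos]
      refine mul_le_mul_of_nonneg_left ?_ (by positivity)
      refine (Finset.sum_le_card_nsmul _ _ ‖V.toBCF‖ fun i _ => ?_).trans (by simp)
      exact (le_abs_self _).trans (V.toBCF.norm_coe_le_norm (x i))
  refine ⟨(scaledM N V k).toReal, (EReal.coe_toReal ?_ ?_).symm⟩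
  · exact (h1.trans_lt (EReal.coe_lt_top _)).ne
  · exact (lt_of_lt_of_le (EReal.bot_lt_zero) h0).ne'

/-- If at most `k` of `m ≤ N` points see values of `V` above `δ`, then the value of the
configuration is at most that of the supremum for `k` points, plus `δ`. -/
theorem ofReal_scaledSum_sub_le (hd : 1 ≤ d) {N : ℕ} (hN : 1 ≤ N) {V : C₀(Space d, ℝ)}
    {k m : ℕ} (hm : m ≤ N) {s δ : ℝ} (hδ : 0 ≤ δ) (hs : scaledM N V k ≤ s) (x : Fin m → Space d)
    (A : Finset (Fin m)) (hA : A.card ≤ k) (hV : ∀ a ∉ A, V (x a) ≤ δ) :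
    ENNReal.ofReal (scaledSum N V x - (s + δ)) ≤ coulombCost m x := by
  classical
  let e : Fin A.card ↪o Fin m := A.orderEmbOfFin rfl
  have he (a : Fin m) : a ∈ Set.range e ↔ a ∈ A := by
    rw [Finset.range_orderEmbOfFin]; rfl
  have h1 := scaledM_le_iff.1 ((scaledM_mono hd N V hA).trans hs) (x ∘ e)
  refine le_trans (ENNReal.ofReal_le_ofReal ?_) (h1.trans (coulombCost_comp_orderEmb_le e x))
  have hN' : (0 : ℝ) < N := by exact_mod_cast hN
  have h2 : ∑ a, V (x a) ≤ ∑ i, V ((x ∘ e) i) + N * δ := by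
    have h3 := sum_comp_orderEmb e (fun a => V (x a))
    simp only [Function.comp_apply, h3]
    calc ∑ a, V (x a) ≤ ∑ a, ((if a ∈ Set.range e then V (x a) else 0) + δ) := by
          refine Finset.sum_le_sum fun a _ => ?_
          by_cases ha : a ∈ A
          · simp [he, ha, hδ]
          · simpa [he, ha] using hV a ha
      _ ≤ _ := by
          rw [Finset.sum_add_distrib]
          simp only [Finset.sum_const, Finset.card_univ, Fintype.card_fin, nsmul_eq_mul]
          gcongr
  have h4 : scaledSum N V x ≤ scaledSum N V (x ∘ e) + δ := by
    have := mul_le_mul_of_nonneg_left h2 (by positivity : 0 ≤ 1 / (N : ℝ))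
    unfold scaledSum
    refine this.trans (le_of_eq ?_)
    field_simp
  linarith

theorem exists_abs_le_of_lt_norm (V : C₀(Space d, ℝ)) {δ : ℝ} (hδ : 0 < δ) :
    ∃ R : ℝ, ∀ x, R < ‖x‖ → |V x| ≤ δ := by
  have h := V.zero_at_infty'.eventually (Metric.closedBall_mem_nhds 0 hδ)
  rw [← Metric.cobounded_eq_cocompact, ← comap_norm_atTop, eventually_comap] at h
  obtain ⟨R, hR⟩ := eventually_atTop.1 h
  refine ⟨R, fun x hx => ?_⟩
  simpa using hR ‖x‖ hx.le x rfl

/-- A strict increase of the suprema prevents the loss of points at infinity, so that the supremum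
is attained. -/
theorem exists_scaledM_eq (hd : 1 ≤ d) {N : ℕ} (hN : 1 ≤ N) (V : C₀(Space d, ℝ)) {k : ℕ}
    (hk : k + 1 ≤ N) (hlt : scaledM N V k < scaledM N V (k + 1)) :
    ∃ x : Fin (k + 1) → Space d,
      scaledM N V (k + 1) = (scaledSum N V x : EReal) - (coulombCost (k + 1) x : EReal) := by
  obtain ⟨s, hs⟩ := exists_scaledM_eq_coe hd N V k
  obtain ⟨t, ht⟩ := exists_scaledM_eq_coe hd N V (k + 1)
  have hst : s < t := by rwa [hs, ht, EReal.coe_lt_coe_iff] at hlt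
  -- With half the gap as tolerance, a configuration with a point beyond R has value at most (s +
  -- t)/2 < t, so the supremum is decided on a compact ball.
  obtain ⟨R, hR⟩ := exists_abs_le_of_lt_norm V (half_pos (sub_pos.2 hst))
  have hout : ∀ x : Fin (k + 1) → Space d, x ∉ Metric.closedBall 0 (max R 0) →
      (scaledSum N V x : EReal) - (coulombCost (k + 1) x : EReal) ≤
        ((s + (t - s) / 2 : ℝ) : EReal) := by
    intro x hx
    rw [coe_sub_coe_ennreal_le_iff]
    have : ∃ a, R < ‖x a‖ := by
      by_contra! h
      exact hx (mem_closedBall_zero_iff.2 ((pi_norm_le_iff_of_nonneg (le_max_right _ _)).2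
        fun a => (h a).trans (le_max_left _ _)))
    obtain ⟨a, ha⟩ := this
    refine ofReal_scaledSum_sub_le hd hN hk (by linarith) hs.le x (Finset.univ.erase a) (by simp) ?_
    intro b hb
    obtain rfl : b = a := by simpa using hb
    exact (le_abs_self _).trans (hR _ ha)
  have hcont : Continuous fun x : Fin (k + 1) → Space d =>
      (scaledSum N V x : EReal) - (coulombCost (k + 1) x : EReal) := by
    simp_rw [sub_eq_add_neg]
    refine continuous_iff_continuousAt.2 fun x => ?_
    have h1 : ContinuousAt (fun x : Fin (k + 1) → Space d => (scaledSum N V x : EReal)) x := by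
      refine (continuous_coe_real_ereal.comp ?_).continuousAt
      unfold scaledSum
      exact continuous_const.mul (continuous_finsetSum _ fun i _ =>
        (map_continuous V).comp (continuous_apply i))
    have h2 : ContinuousAt
        (fun x : Fin (k + 1) → Space d => -(coulombCost (k + 1) x : EReal)) x :=
      ((continuous_coe_ennreal_ereal.comp (continuous_coulombCost (k + 1))).neg).continuousAt
    exact ContinuousAt.comp (f := fun x : Fin (k + 1) → Space d =>
      ((scaledSum N V x : EReal), -(coulombCost (k + 1) x : EReal)))
      (EReal.continuousAt_add (Or.inl (EReal.coe_ne_top _)) (Or.inl (EReal.coe_ne_bot _)))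
      (h1.prodMk h2)
  obtain ⟨x, -, hx⟩ := (isCompact_closedBall (0 : Fin (k + 1) → Space d) (max R 0)).exists_isMaxOn
    ⟨0, by simp⟩ hcont.continuousOn
  refine ⟨x, le_antisymm ?_ (le_iSup (fun x : Fin (k + 1) → Space d =>
    (scaledSum N V x : EReal) - (coulombCost (k + 1) x : EReal)) x)⟩
  by_contra! hcon
  have hle : scaledM N V (k + 1) ≤ max ((scaledSum N V x : EReal) - (coulombCost (k + 1) x : EReal))
      ((s + (t - s) / 2 : ℝ) : EReal) := by
    refine iSup_le fun y => ?_
    by_cases hy : y ∈ Metric.closedBall 0 (max R 0)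
    · exact le_max_of_le_left (hx hy)
    · exact le_max_of_le_right (hout y hy)
  refine hle.not_gt (max_lt hcon ?_)
  rw [ht, EReal.coe_lt_coe_iff]
  linarith

/-! ### Lower bounds for the relaxed cost -/

theorem _root_.MeasureTheory.ofReal_integral_le_lintegral_ofReal {α : Type*}
    {_ : MeasurableSpace α} {μ : Measure α} {f : α → ℝ} (hf : Integrable f μ) :
    ENNReal.ofReal (∫ a, f a ∂μ) ≤ ∫⁻ a, ENNReal.ofReal (f a) ∂μ := by
  refine ENNReal.ofReal_le_of_le_toReal ?_
  rw [integral_eq_lintegral_pos_part_sub_lintegral_neg_part hf]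
  exact sub_le_self _ ENNReal.toReal_nonneg

theorem integrable_zeroAtInfty (φ : C₀(Space d, ℝ)) (μ : Measure (Space d)) [IsFiniteMeasure μ] :
    Integrable (fun x => φ x) μ :=
  φ.toBCF.integrable μ

/-- The easy half of Kantorovich duality: the hypothesis bounds c_N below pointwise by (1/N)∑W(x_i)
- s, whose integral against any plan depends only on the marginal. -/
theorem ofReal_integral_sub_le_transportCost {N : ℕ} (hN : 1 ≤ N) {W : C₀(Space d, ℝ)} {s : ℝ}
    (h : scaledM N W N ≤ s) (ρ : Measure (Space d)) :
    ENNReal.ofReal (∫ x, W x ∂ρ - s) ≤ transportCost N ρ := by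
  refine le_iInf₂ fun P hP => ?_
  obtain ⟨hprob, hmarg⟩ := hP
  have hi (i : Fin N) : Integrable (fun x : Fin N → Space d => W (x i)) P := by
    have : IsFiniteMeasure ρ := hmarg i ▸ inferInstance
    exact (hmarg i ▸ integrable_zeroAtInfty W ρ :
      Integrable (fun y => W y) (P.map fun x => x i)).comp_measurable (measurable_pi_apply i)
  have hint (i : Fin N) : ∫ x, W (x i) ∂P = ∫ x, W x ∂ρ := by
    rw [← hmarg i, integral_map (measurable_pi_apply i).aemeasurable
      (map_continuous W).aestronglyMeasurable]
  have hsum : Integrable (fun x : Fin N → Space d => scaledSum N W x) P :=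
    (integrable_finsetSum _ fun i _ => hi i).const_mul _
  have heq : ∫ x, (scaledSum N W x - s) ∂P = ∫ x, W x ∂ρ - s := by
    rw [integral_sub hsum (integrable_const s)]
    unfold scaledSum
    rw [integral_const_mul, integral_finsetSum _ fun i _ => hi i]
    simp_rw [hint]
    have : (N : ℝ) ≠ 0 := by positivity
    simp [this]
  rw [← heq]
  exact (ofReal_integral_le_lintegral_ofReal (hsum.sub (integrable_const s))).trans
    (lintegral_mono fun x => scaledM_le_iff.1 h x)

/-- The dual bound survives relaxation because W vanishes at infinity and so is itself a weak* test
function. -/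
theorem ofReal_integral_sub_le_relaxedCost {N : ℕ} (hN : 1 ≤ N) {W : C₀(Space d, ℝ)} {s : ℝ}
    (h : scaledM N W N ≤ s) (ρ : Measure (Space d)) :
    ENNReal.ofReal (∫ x, W x ∂ρ - s) ≤ relaxedCost N ρ := by
  refine le_sInf ?_
  rintro _ ⟨ρs, -, hconv, rfl⟩
  rw [← (ENNReal.tendsto_ofReal ((hconv W).sub_const s)).liminf_eq]
  exact liminf_le_liminf (Eventually.of_forall fun n =>
    ofReal_integral_sub_le_transportCost hN h (ρs n))

/-! ### Quantized measures -/

/-- The measure `(1/N) ∑ δ_{x_i}`. -/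
noncomputable def pointMass (N : ℕ) {k : ℕ} (x : Fin k → Space d) : Measure (Space d) :=
  (N : ℝ≥0∞)⁻¹ • ∑ i, Measure.dirac (x i)

theorem pointMass_univ (N : ℕ) {k : ℕ} (x : Fin k → Space d) :
    pointMass N x Set.univ = (N : ℝ≥0∞)⁻¹ * k := by
  simp [pointMass]

theorem integral_pointMass (N : ℕ) {k : ℕ} (x : Fin k → Space d) (φ : C₀(Space d, ℝ)) :
    ∫ y, φ y ∂pointMass N x = scaledSum N φ x := by
  rw [pointMass, integral_smul_measure, integral_finsetSum_measure
    fun i _ => integrable_zeroAtInfty φ _]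
  simp [scaledSum]

theorem transportCost_pointMass_le {N : ℕ} (hN : 1 ≤ N) (z : Fin N → Space d) :
    transportCost N (pointMass N z) ≤ coulombCost N z := by
  have : NeZero N := ⟨by omega⟩
  have hN0 : (N : ℝ≥0∞) ≠ 0 := by simp; omega
  have hcancel : (N : ℝ≥0∞)⁻¹ * N = 1 := ENNReal.inv_mul_cancel hN0 (by simp)
  -- Averaging over the N cyclic shifts makes every coordinate uniform on the points, while each
  -- shift has the cost of z.
  let P : Measure (Fin N → Space d) :=
    (N : ℝ≥0∞)⁻¹ • ∑ r : Fin N, Measure.dirac (z ∘ Equiv.addRight r)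
  have hP : P ∈ plans N (pointMass N z) := by
    refine ⟨⟨by simp [P, hcancel]⟩, fun i => ?_⟩
    have hm : Measurable fun x : Fin N → Space d => x i := measurable_pi_apply i
    rw [Measure.map_smul, Measure.map_finset_sum' hm.aemeasurable]
    simp_rw [Measure.map_dirac' hm]
    rw [pointMass, ← Equiv.sum_comp (Equiv.addLeft i) fun a => Measure.dirac (z a)]
    rfl
  refine (iInf₂_le P hP).trans (le_of_eq ?_)
  simp only [P, lintegral_smul_measure, lintegral_finsetSum_measure, lintegral_dirac,
    coulombCost_comp_perm, Finset.sum_const, Finset.card_univ, Fintype.card_fin, nsmul_eq_mul,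
    smul_eq_mul]
  rw [← mul_assoc, hcancel, one_mul]

/-- The recovery sequence adds N - k escaping points of mass 1/N: they restore total mass 1 and
disappear in the weak* limit. -/
theorem relaxedCost_pointMass_le (hd : 1 ≤ d) {N k : ℕ} (hN : 1 ≤ N) (hk : k ≤ N)
    (x : Fin k → Space d) : relaxedCost N (pointMass N x) ≤ coulombCost k x := by
  obtain ⟨z, hz, hzφ⟩ := exists_escaping_extension hd (Fin.castLEOrderEmb hk) x
  have hN0 : (N : ℝ≥0∞) ≠ 0 := by simp; omega
  refine (sInf_le ⟨fun n => pointMass N (z n), fun n => ⟨?_⟩, fun φ => ?_, rfl⟩ :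
    relaxedCost N _ ≤ _).trans ?_
  · rw [pointMass_univ, ENNReal.inv_mul_cancel hN0 (by simp)]
  · simp_rw [integral_pointMass]
    exact (hzφ φ).const_mul _
  · rw [← hz.liminf_eq]
    exact liminf_le_liminf (Eventually.of_forall fun n => transportCost_pointMass_le hN (z n))

theorem pointMass_mem_subProb {N k : ℕ} (hN : 1 ≤ N) (hk : k ≤ N) (x : Fin k → Space d) :
    pointMass N x ∈ subProb d := by
  change pointMass N x Set.univ ≤ 1
  rw [pointMass_univ, ← ENNReal.inv_mul_cancel (a := (N : ℝ≥0∞)) (by simp; omega) (by simp)]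
  gcongr

/-! ### Minimizers -/

theorem neg_le_energy {N : ℕ} (hN : 1 ≤ N) {V : C₀(Space d, ℝ)} {s : ℝ}
    (h : scaledM N V N ≤ s) (ρ : Measure (Space d)) : ((-s : ℝ) : EReal) ≤ energy N V ρ := by
  have h1 := ofReal_integral_sub_le_relaxedCost hN h ρ
  rw [← coe_sub_coe_ennreal_le_iff] at h1
  unfold energy
  rw [EReal.le_sub_iff_add_le (Or.inl (EReal.coe_ne_bot _)) (Or.inl (EReal.coe_ne_top _))]
  induction hr : relaxedCost N ρ with
  | top => simp
  | coe c =>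
    rw [hr, EReal.coe_nnreal_eq_coe_real] at h1
    rw [EReal.coe_nnreal_eq_coe_real]
    norm_cast at h1 ⊢
    linarith

theorem energy_pointMass_le (hd : 1 ≤ d) {N k : ℕ} (hN : 1 ≤ N) (hk : k ≤ N)
    (V : C₀(Space d, ℝ)) (x : Fin k → Space d) :
    energy N V (pointMass N x) ≤ -((scaledSum N V x : EReal) - (coulombCost k x : EReal)) := by
  rw [energy, integral_pointMass, EReal.neg_sub (Or.inl (EReal.coe_ne_bot _))
    (Or.inl (EReal.coe_ne_top _)), add_comm, ← sub_eq_add_neg]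
  refine EReal.sub_le_sub ?_ le_rfl
  exact_mod_cast relaxedCost_pointMass_le hd hN hk x

/-- If `k + 1` points see a strict increase of the supremum, then every measure of minimal energy
has mass at least `(k + 1) / N`. -/
theorem le_measureReal_of_energy_le (hd : 1 ≤ d) {N k : ℕ} (hN : 1 ≤ N) {V : C₀(Space d, ℝ)}
    {t : ℝ} (ht : scaledM N V N = t) (hlt : scaledM N V k < scaledM N V N)
    {ρ : Measure (Space d)} (hρ : ρ ∈ subProb d) (hE : energy N V ρ ≤ ((-t : ℝ) : EReal)) :
    ((k + 1 : ℕ) : ℝ) / N ≤ ρ.real Set.univ := by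
  have : IsFiniteMeasure ρ := ⟨lt_of_le_of_lt hρ ENNReal.one_lt_top⟩
  obtain ⟨s, hs⟩ := exists_scaledM_eq_coe hd N V k
  have hst : s < t := by rwa [hs, ht, EReal.coe_lt_coe_iff] at hlt
  have hN' : (0 : ℝ) < N := by exact_mod_cast hN
  set δ := (t - s) / 2 with hδ
  have hδ0 : 0 < δ := half_pos (sub_pos.2 hst)
  obtain ⟨R, hR⟩ := exists_abs_le_of_lt_norm V hδ0
  obtain ⟨f, hf1, hfc, -, hf01⟩ := exists_continuousMap_one_of_isCompact_subset_isOpen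
    (isCompact_closedBall (0 : Space d) R) isOpen_univ (Set.subset_univ _)
  let φ : C₀(Space d, ℝ) := ⟨f, HasCompactSupport.is_zero_at_infty hfc⟩
  have hφ0 (x : Space d) : 0 ≤ φ x := (hf01 x).1
  have hφle (x : Space d) : φ x ≤ 1 := (hf01 x).2
  have hφ1 (x : Space d) (hx : ‖x‖ ≤ R) : φ x = 1 := hf1 (mem_closedBall_zero_iff.2 hx)
  -- Chosen so that c(k + 1)/N = δ: k + 1 points in the ball lose at least δ from the scaled sum.
  let c : ℝ := N * δ / (k + 1)
  have hc : 0 < c := by positivity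
  let W : C₀(Space d, ℝ) := V - c • φ
  have hW : scaledM N W N ≤ ((t - δ : ℝ) : EReal) := by
    refine scaledM_le_iff.2 fun x => ?_
    have hWx : scaledSum N W x = scaledSum N V x - δ / (k + 1) * ∑ i, φ (x i) := by
      simp only [scaledSum, W, c, ZeroAtInftyContinuousMap.sub_apply,
        ZeroAtInftyContinuousMap.smul_apply, smul_eq_mul, Finset.sum_sub_distrib,
        ← Finset.mul_sum]
      field_simp
    let A : Finset (Fin N) := Finset.univ.filter fun i => ‖x i‖ ≤ R
    -- With at most k points in the ball the value is at most s + δ = t - δ, by the choice of δ;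
    -- with more, the bump takes off δ from a value at most t.
    rcases le_or_gt A.card k with hA | hA
    · refine le_trans (ENNReal.ofReal_le_ofReal ?_) (ofReal_scaledSum_sub_le hd hN le_rfl hδ0.le
        hs.le x A hA fun a ha => (le_abs_self _).trans (hR _ (by simpa [A] using ha)))
      have : 0 ≤ δ / (k + 1) * ∑ i, φ (x i) :=
        mul_nonneg (by positivity) (Finset.sum_nonneg fun i _ => hφ0 _)
      linarith
    · refine le_trans (ENNReal.ofReal_le_ofReal ?_) (scaledM_le_iff.1 ht.le x)
      have h1 : ((k + 1 : ℕ) : ℝ) ≤ ∑ i, φ (x i) :=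
        calc ((k + 1 : ℕ) : ℝ) ≤ A.card := by exact_mod_cast hA
          _ = ∑ i ∈ A, φ (x i) := by
            rw [Finset.sum_congr rfl fun i hi => hφ1 (x i) (by simpa [A] using hi)]
            simp
          _ ≤ _ := Finset.sum_le_sum_of_subset_of_nonneg (Finset.subset_univ _)
            fun i _ _ => hφ0 _
      have h2 : δ ≤ δ / (k + 1) * ∑ i, φ (x i) := by
        calc δ = δ / (k + 1) * ((k + 1 : ℕ) : ℝ) := by push_cast; field_simp
          _ ≤ _ := by gcongr
      linarith
  have hlow := ofReal_integral_sub_le_relaxedCost hN hW ρ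
  have hWint : ∫ x, W x ∂ρ = ∫ x, V x ∂ρ - c * ∫ x, φ x ∂ρ := by
    simp only [W, ZeroAtInftyContinuousMap.sub_apply, ZeroAtInftyContinuousMap.smul_apply,
      smul_eq_mul]
    rw [integral_sub (integrable_zeroAtInfty V ρ) ((integrable_zeroAtInfty φ ρ).const_mul c),
      integral_const_mul]
  have hφint : ∫ x, φ x ∂ρ ≤ ρ.real Set.univ := by
    calc ∫ x, φ x ∂ρ ≤ ∫ _, (1 : ℝ) ∂ρ :=
          integral_mono (integrable_zeroAtInfty φ ρ) (integrable_const _) hφle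
      _ = _ := by simp
  -- Minimality gives C̄(ρ) ≤ ∫V dρ - t, while duality for W gives C̄(ρ) ≥ ∫V dρ - c∫φ dρ - (t - δ).
  have hmain : δ ≤ c * ∫ x, φ x ∂ρ := by
    rw [← coe_sub_coe_ennreal_le_iff, hWint] at hlow
    unfold energy at hE
    rw [EReal.sub_le_iff_le_add (Or.inl (EReal.coe_ne_bot _)) (Or.inl (EReal.coe_ne_top _))] at hE
    induction hr : relaxedCost N ρ with
    | top =>
      rw [hr, ← EReal.coe_add, EReal.coe_ennreal_top] at hE
      exact absurd hE (EReal.coe_lt_top _).not_ge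
    | coe r =>
      rw [hr, EReal.coe_nnreal_eq_coe_real] at hE hlow
      norm_cast at hE hlow
      linarith
  have h3 : δ ≤ c * ρ.real Set.univ := hmain.trans (mul_le_mul_of_nonneg_left hφint hc.le)
  have h4 : δ * (((k + 1 : ℕ) : ℝ) / N) ≤ δ * ρ.real Set.univ := by
    calc δ * (((k + 1 : ℕ) : ℝ) / N) ≤ c * ρ.real Set.univ * (((k + 1 : ℕ) : ℝ) / N) := by gcongr
      _ = δ * ρ.real Set.univ := by simp only [c]; push_cast; field_simp
  exact le_of_mul_le_mul_left h4 hδ0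

/-! ### The index `k_N(V)` -/

theorem mem_strictIndices_iff {N : ℕ} {V : C₀(Space d, ℝ)} {k : ℕ} :
    k ∈ strictIndices N V ↔ 1 ≤ k ∧ k ≤ N ∧ scaledM N V (k - 1) < scaledM N V k := by
  simp only [strictIndices, Set.mem_ofPred_eq, M_smul]

theorem isGreatest_strictIndices {N : ℕ} (hN : 1 ≤ N) {V : C₀(Space d, ℝ)} (hV : ∃ x, 0 < V x) :
    IsGreatest (strictIndices N V) (kIndex N V) := by
  have hbdd : BddAbove (strictIndices N V) := ⟨N, fun k hk => hk.2.1⟩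
  have hne : (strictIndices N V).Nonempty := by
    refine ⟨1, mem_strictIndices_iff.2 ⟨le_rfl, hN, ?_⟩⟩
    obtain ⟨x, hx⟩ := hV
    have hN' : (0 : ℝ) < N := by exact_mod_cast hN
    rw [Nat.sub_self, scaledM_zero]
    refine lt_of_lt_of_le ?_ (le_iSup _ fun _ : Fin 1 => x)
    simp only [scaledSum, coulombCost, Finset.univ_unique, Finset.sum_singleton]
    have : (0 : EReal) < ((1 / (N : ℝ) * V x : ℝ) : EReal) :=
      EReal.coe_pos.2 (by positivity)
    simpa using this
  rw [kIndex, if_pos hV]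
  exact ⟨Nat.sSup_mem hne hbdd, fun k hk => le_csSup hbdd hk⟩

theorem kIndex_le {N : ℕ} (hN : 1 ≤ N) (V : C₀(Space d, ℝ)) : kIndex N V ≤ N := by
  by_cases hV : ∃ x, 0 < V x
  · exact (isGreatest_strictIndices hN hV).1.2.1
  · simp [kIndex, hV]

/-- Beyond the last strict increase a monotone sequence is constant; if V ≤ 0, every supremum is 0.
-/
theorem scaledM_kIndex (hd : 1 ≤ d) {N : ℕ} (hN : 1 ≤ N) (V : C₀(Space d, ℝ)) :
    scaledM N V (kIndex N V) = scaledM N V N := by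
  by_cases hV : ∃ x, 0 < V x
  · have hmax := isGreatest_strictIndices hN hV
    have : ∀ j, kIndex N V ≤ j → j ≤ N → scaledM N V (kIndex N V) = scaledM N V j := by
      intro j hj
      induction j, hj using Nat.le_induction with
      | base => exact fun _ => rfl
      | succ j hj ih =>
        intro hjN
        rw [ih (by omega)]
        refine (scaledM_mono hd N V j.le_succ).antisymm (le_of_not_gt fun hlt => ?_)
        have := hmax.2 (mem_strictIndices_iff.2 ⟨by omega, hjN, hlt⟩)
        omega
    exact this N (kIndex_le hN V) le_rfl
  · refine (scaledM_mono hd N V (kIndex_le hN V)).antisymm ?_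
    rw [kIndex, if_neg hV, scaledM_zero, ← EReal.coe_zero]
    refine scaledM_le_iff.2 fun x => ?_
    push Not at hV
    rw [ENNReal.ofReal_of_nonpos]
    · exact zero_le
    · rw [sub_zero]
      exact mul_nonpos_of_nonneg_of_nonpos (by positivity) (Finset.sum_nonpos fun i _ => hV _)

theorem exists_scaledM_kIndex_eq (hd : 1 ≤ d) {N : ℕ} (hN : 1 ≤ N) (V : C₀(Space d, ℝ)) :
    ∃ x : Fin (kIndex N V) → Space d, scaledM N V (kIndex N V) =
      (scaledSum N V x : EReal) - (coulombCost (kIndex N V) x : EReal) := by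
  by_cases hV : ∃ x, 0 < V x
  · obtain ⟨h1, h2, h3⟩ := mem_strictIndices_iff.1 (isGreatest_strictIndices hN hV).1
    generalize kIndex N V = k at *
    obtain ⟨k, rfl⟩ := Nat.exists_eq_succ_of_ne_zero (by omega : k ≠ 0)
    exact exists_scaledM_eq hd hN V h2 h3
  -- Here the empty configuration attains the supremum, and the minimizer it yields is the zero
  -- measure.
  · have h0 : kIndex N V = 0 := by simp [kIndex, hV]
    rw [h0, scaledM_zero]
    exact ⟨0, by simp [scaledSum, coulombCost]⟩

theorem isLeast_minimizerMasses (hd : 1 ≤ d) {N : ℕ} (hN : 1 ≤ N) (V : C₀(Space d, ℝ)) :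
    IsLeast (minimizerMasses N V) ((kIndex N V : ℝ) / N) := by
  obtain ⟨t, ht⟩ := exists_scaledM_eq_coe hd N V N
  obtain ⟨x, hx⟩ := exists_scaledM_kIndex_eq hd hN V
  have hk := kIndex_le hN V
  have hmem := pointMass_mem_subProb hN hk x
  have hmin : energy N V (pointMass N x) ≤ ((-t : ℝ) : EReal) := by
    refine (energy_pointMass_le hd hN hk V x).trans (le_of_eq ?_)
    rw [← hx, scaledM_kIndex hd hN V, ht, EReal.coe_neg]
  refine ⟨⟨_, ⟨hmem, fun σ _ => hmin.trans (neg_le_energy hN ht.le σ)⟩, ?_⟩, ?_⟩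
  · rw [measureReal_def, pointMass_univ]
    simp [div_eq_inv_mul]
  · rintro _ ⟨ρ, ⟨hρ, hρmin⟩, rfl⟩
    by_cases hV : ∃ x, 0 < V x
    · obtain ⟨h1, -, h3⟩ := mem_strictIndices_iff.1 (isGreatest_strictIndices hN hV).1
      rw [scaledM_kIndex hd hN V] at h3
      have := le_measureReal_of_energy_le hd hN ht h3 hρ ((hρmin _ hmem).trans hmin)
      rwa [Nat.sub_add_cancel h1] at this
    · simp [kIndex, hV]

end CoulombMass

theorem mainTheorem4 (d N : ℕ) (hd : 1 ≤ d) (hN : 1 ≤ N) :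
    (∀ V : C₀(CoulombMass.Space d, ℝ),
      ((∃ x, 0 < V x) →
        IsGreatest (CoulombMass.strictIndices N V) (CoulombMass.kIndex N V)) ∧
      IsLeast (CoulombMass.minimizerMasses N V) (CoulombMass.minMass N V) ∧
      CoulombMass.minMass N V = (CoulombMass.kIndex N V : ℝ) / (N : ℝ)) ∧
    Set.range (fun V : C₀(CoulombMass.Space d, ℝ) => CoulombMass.minMass N V) ⊆
      {m : ℝ | ∃ k : ℕ, k ≤ N ∧ m = (k : ℝ) / (N : ℝ)} := by
  have hleast (V : C₀(CoulombMass.Space d, ℝ)) :=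
    CoulombMass.isLeast_minimizerMasses hd hN V
  have heq (V : C₀(CoulombMass.Space d, ℝ)) :
      CoulombMass.minMass N V = (CoulombMass.kIndex N V : ℝ) / (N : ℝ) := (hleast V).csInf_eq
  refine ⟨fun V => ⟨CoulombMass.isGreatest_strictIndices hN, ?_, heq V⟩, ?_⟩
  · rw [heq V]
    exact hleast V
  · rintro _ ⟨V, rfl⟩
    exact ⟨CoulombMass.kIndex N V, CoulombMass.kIndex_le hN V, heq V⟩
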